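/- Let $t_0<T$, let $f:[t_0,T]\times\mathbb{R}^d\to\mathbb{R}^d$ be sufficiently smooth, where for an integer $p\ge 1$ it is enough that $f$ is $C^{p+1}$, and let $y$ be the solution of the initial-value problem $y'(t)=f(t,y(t))$, $y(t_0)=y_0$, on $[t_0,T]$. Consider a $k$-step linear multistep method (LMM) $$\sum_{j=0}^k\alpha_j y_{n+j}=h\sum_{j=0}^k\beta_j f(t_{n+j},y_{n+j}),\qquad t_n=t_0+nh,\quad \alpha_j,\beta_j\in\mathbb{R},\quad \alpha_k\neq 0,$$ that is of order (at least) $p$, i.e. $\sum_{j=0}^k\bigl(\alpha_j u(t+jh)-h\beta_j u'(t+jh)\bigr)=O(h^{p+1})$ as $h\to0^+$ for every smooth $u$ and every $t$, and that is zero-stable, i.e. there is a constant $K$ such that any two sequences $(u_n),(v_n)$ generated by the method for the equation $y'=0$ satisfy $|u_n-v_n|\le K\max_{0\le j<k}|u_j-v_j|$ for all $n$. Let $H\subset(0,\infty)$ be a set of step sizes (for example all $h>0$ small enough, or all $h=(T-t_0)/N$ with $N$ large enough) such that for each $h\in H$ the sequences $y_n(h)$ and $y_n(h/2)$ satisfy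 the recursion of the LMM with step size $h$ and $h/2$, respectively, at the grid points in $[t_0,T]$. If the method is implicit ($\beta_k\ne0$) and $f$ is not Lipschitz continuous in its second argument uniformly in $t\in[t_0,T]$, assume that the roots of the implicit equations are chosen such that $\|y_{n+1}(h)-y_n(h)\|$ and $\|y_{n+1}(h/2)-y_n(h/2)\|$, for $n+1\ge k$ and as long as the grid points are in $[t_0,T]$, are bounded by a constant independent of $n$ and $h\in H$. Assume that the starting values on both grids are $O(h^{p+1})$-accurate: for $0\le j\le k-1$, $y_j(h)-y(t_0+jh)=O(h^{p+1})$ and $y_j(h/2)-y(t_0+jh/2)=O(h^{p+1})$ as $h\to0$ in $H$. Then the globally extrapolated sequence $$r_n(h)=\frac{2^p}{2^p-1}\,y_{2n}\!\left(\frac h2\right)-\frac{1}{2^p-1}\,y_n(h)$$ converges to the exact solution with order at least $p+1$: there are constants $C$ and $h_0>0$ such that $\|r_n(h)-y(t_0+nh)\|\le C\,h^{p+1}$ for all $h\in H$ with $h<h_0$ and all $n\ge0$ with $t_0+nh\le T$. -/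

import Mathlib

open Set Filter Topology Asymptotics
open scoped NNReal ContDiff

noncomputable section

/-- The coefficients of a `k`-step linear multistep method
`∑_{j=0}^k α_j y_{n+j} = h ∑_{j=0}^k β_j f_{n+j}` with `α_k ≠ 0`.
Only the entries with index `0, …, k` are ever used. -/
structure LMM (k : ℕ) where
  α : ℕ → ℝ
  β : ℕ → ℝ
  lead_ne_zero : α k ≠ 0

namespace LMM

variable {k : ℕ}

/-- The method has order (at least) `p`: for every smooth `u`, the linear difference operator
`∑_j (α_j u(t + j h) - h β_j u'(t + j h))` is `O(h^{p+1})` as `h → 0⁺`. -/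
def HasOrder (m : LMM k) (p : ℕ) : Prop :=
  ∀ u : ℝ → ℝ, ContDiff ℝ ∞ u → ∀ t : ℝ,
    (fun h : ℝ => ∑ j ∈ Finset.range (k + 1),
        (m.α j * u (t + j * h) - h * m.β j * deriv u (t + j * h)))
      =O[𝓝[>] 0] fun h : ℝ => h ^ (p + 1)

/-- Zero-stability: there is a constant `K` such that any two sequences generated by the method for
`y' = 0` from different starting values differ by at most `K` times the largest difference of
their starting values. -/
def ZeroStable (m : LMM k) : Prop :=
  ∃ K : ℝ, ∀ u v : ℕ → ℝ,
    (∀ n, ∑ j ∈ Finset.range (k + 1), m.α j * u (n + j) = 0) →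
    (∀ n, ∑ j ∈ Finset.range (k + 1), m.α j * v (n + j) = 0) →
    ∀ M : ℝ, (∀ j < k, |u j - v j| ≤ M) → ∀ n, |u n - v n| ≤ K * M

/-- The method is explicit if `β_k = 0`. -/
def IsExplicit (m : LMM k) : Prop := m.β k = 0

variable {E : Type*} [NormedAddCommGroup E] [NormedSpace ℝ E]

/-- The sequence `u` is generated by the method with step size `h`, applied to `y' = f(t, y)` on the
grid `t_n = t₀ + n h`, as far as the grid points lie in `[t₀, T]`. -/
def Generates (m : LMM k) (f : ℝ → E → E) (t₀ T h : ℝ) (u : ℕ → E) : Prop :=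
  ∀ n : ℕ, t₀ + ((n + k : ℕ) : ℝ) * h ≤ T →
    ∑ j ∈ Finset.range (k + 1), m.α j • u (n + j) =
      ∑ j ∈ Finset.range (k + 1), (h * m.β j) • f (t₀ + ((n + j : ℕ) : ℝ) * h) (u (n + j))

end LMM

variable {E : Type*} [NormedAddCommGroup E] [NormedSpace ℝ E]

/-- `y` solves `y'(t) = f(t, y(t))`, `y(t₀) = y₀` on `[t₀, T]` (one-sided derivatives at the
end points). -/
def IsIVPSolution (f : ℝ → E → E) (t₀ T : ℝ) (y₀ : E) (y : ℝ → E) : Prop :=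
  y t₀ = y₀ ∧ ∀ t ∈ Icc t₀ T, HasDerivWithinAt y (f t (y t)) (Icc t₀ T) t

/-- Each value of `u` computed by a `k`-step method (index at least `k`, grid point in `[t₀, T]`) is
within distance `M` of the preceding value. -/
def StepsBoundedBy (k : ℕ) (t₀ T h M : ℝ) (u : ℕ → E) : Prop :=
  ∀ n : ℕ, k ≤ n + 1 → t₀ + ((n + 1 : ℕ) : ℝ) * h ≤ T → ‖u (n + 1) - u n‖ ≤ M

/-- The globally extrapolated sequence
`r_n(h) = 2^p / (2^p - 1) · y_{2n}(h/2) - 1 / (2^p - 1) · y_n(h)`, where `Y h n` is `y_n(h)`. -/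
def globalExtrapolation (p : ℕ) (Y : ℝ → ℕ → E) (h : ℝ) (n : ℕ) : E :=
  ((2 : ℝ) ^ p / ((2 : ℝ) ^ p - 1)) • Y (h / 2) (2 * n) - (1 / ((2 : ℝ) ^ p - 1)) • Y h n

/-- The grid functions `r h` (step sizes `h ∈ H`) converge to `y` on `[t₀, T]` with order at least
`q`, as `h → 0`: `‖r_n(h) - y(t_n)‖ ≤ C h^q`, uniformly in the grid points `t_n = t₀ + n h ≤ T`. -/
def ConvergesWithOrder (H : Set ℝ) (t₀ T : ℝ) (r : ℝ → ℕ → E) (y : ℝ → E) (q : ℕ) : Prop :=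
  ∃ C h₀ : ℝ, 0 < h₀ ∧ ∀ h ∈ H, h < h₀ → ∀ n : ℕ, t₀ + n * h ≤ T →
    ‖r h n - y (t₀ + n * h)‖ ≤ C * h ^ q

end

/-! The global error has a smooth leading term: `y_n(h) = y(t_n) + h^p ε(t_n) + O(h^(p+1))`, with
one function `ε` for all step sizes. The weights of `r_n(h)` sum to `1` and annihilate `h^p ε`, so
only the remainder survives.

The function `ε` solves the variational equation `ε' = f_y(t, y) ε - C y^(p+1)`, `ε(t₀) = 0`, where
`y^(p+1)` is a derivative and `C` is the first nonvanishing-order coefficient normalized by `∑ β_j`;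
zero-stability and consistency give `∑ β_j ≠ 0`. With this choice `z = y + h^p ε` satisfies the
method up to `O(h^(p+2))` (`exists_errorCoeff`). Since `ε(t₀) = 0`, the starting values are
`O(h^(p+1))`-close to `z` as well, and stability (`ZeroStable.exists_norm_sub_le`) turns the
residual into an error `O(h^(p+1))`.

Stability rests on discrete variation of constants and a Gronwall argument. As `f` is only locally
Lipschitz, the induction also keeps the earlier errors at most `1`; the alternative in `hroot`
controls the newest, implicitly defined value. -/

/-! ### Zero-stability and the inhomogeneous recurrence -/

namespace LMM

variable {k : ℕ}

/-- The recurrence generated by the method for `y' = 0`. -/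
noncomputable def recurrence (m : LMM k) : LinearRecurrence ℝ where
  order := k
  coeffs j := -(m.α j / m.α k)

theorem isSolution_recurrence_iff (m : LMM k) (u : ℕ → ℝ) :
    m.recurrence.IsSolution u ↔
      ∀ n, ∑ j ∈ Finset.range (k + 1), m.α j * u (n + j) = 0 := by
  have hk := m.lead_ne_zero
  refine forall_congr' fun n => ?_
  change u (n + k) = ∑ i : Fin k, -(m.α i / m.α k) * u (n + i) ↔ _
  rw [Fin.sum_univ_eq_sum_range (fun i => -(m.α i / m.α k) * u (n + i)) k,
    Finset.sum_range_succ]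
  have : ∑ i ∈ Finset.range k, -(m.α i / m.α k) * u (n + i)
      = -(∑ i ∈ Finset.range k, m.α i * u (n + i)) / m.α k := by
    rw [neg_div, Finset.sum_div, ← Finset.sum_neg_distrib]
    exact Finset.sum_congr rfl fun i _ => by ring
  rw [this, eq_div_iff hk]
  constructor <;> intro h <;> linarith

/-- The sequence generated by the method for `y' = 0` from the first `k` entries of `x`. -/
noncomputable def homSol (m : LMM k) (x : ℕ → ℝ) : ℕ → ℝ :=
  m.recurrence.mkSol fun j => x j

theorem homSol_sum (m : LMM k) (x : ℕ → ℝ) (n : ℕ) :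
    ∑ j ∈ Finset.range (k + 1), m.α j * m.homSol x (n + j) = 0 :=
  (m.isSolution_recurrence_iff _).1 (m.recurrence.is_sol_mkSol _) n

theorem homSol_init (m : LMM k) (x : ℕ → ℝ) {j : ℕ} (hj : j < k) : m.homSol x j = x j :=
  m.recurrence.mkSol_eq_init (fun j => x j) ⟨j, hj⟩

theorem eq_homSol (m : LMM k) {u x : ℕ → ℝ}
    (hu : ∀ n, ∑ j ∈ Finset.range (k + 1), m.α j * u (n + j) = 0)
    (hx : ∀ j < k, u j = x j) (n : ℕ) : u n = m.homSol x n :=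
  m.recurrence.eq_mk_of_is_sol_of_eq_init ((m.isSolution_recurrence_iff u).2 hu)
    (fun j => hx j j.2) n

/-- The response of the recurrence to a unit right-hand side. -/
noncomputable def impulse (m : LMM k) : ℕ → ℝ :=
  m.homSol fun j => if j + 1 = k then (m.α k)⁻¹ else 0

theorem impulse_eq_zero (m : LMM k) {n : ℕ} (hn : n + 1 < k) : m.impulse n = 0 := by
  rw [impulse, homSol_init _ _ (by omega), if_neg hn.ne]

/-- Discrete variation of constants. -/
theorem eq_homSol_add_sum_impulse (m : LMM k) (hk : 1 ≤ k) (n : ℕ) : ∀ d : ℕ → ℝ,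
    d n = m.homSol d n + ∑ i ∈ Finset.range n, m.impulse (n - 1 - i) *
      ∑ j ∈ Finset.range (k + 1), m.α j * d (i + j) := by
  induction n with
  | zero => intro d; simp [homSol_init m d hk]
  | succ n ih =>
    intro d
    set g : ℕ → ℝ := fun i => ∑ j ∈ Finset.range (k + 1), m.α j * d (i + j) with hg
    -- Restarting one index later changes the starting data only in the last entry, where `d k`
    -- exceeds the homogeneous continuation by `g 0 / α_k`; the difference is thus `g 0` times the
    -- impulse response.
    have h1 : m.homSol (fun i => d (i + 1)) n = m.homSol d (n + 1) + m.impulse n * g 0 := by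
      symm
      refine m.eq_homSol (u := fun n => m.homSol d (n + 1) + m.impulse n * g 0)
        (fun n => ?_) (fun j hj => ?_) n
      · have e1 := m.homSol_sum d (n + 1)
        have e2 := m.homSol_sum (fun j => if j + 1 = k then (m.α k)⁻¹ else 0) n
        have : ∀ j, n + j + 1 = n + 1 + j := fun j => by ring
        simp only [mul_add, Finset.sum_add_distrib, this, e1, ← mul_assoc, ← Finset.sum_mul]
        unfold impulse
        rw [e2]; ring
      · by_cases hjk : j + 1 = k
        · have e0 : g 0 = _ := rfl
          have e1 := m.homSol_sum d 0
          have e2 := m.lead_ne_zero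
          simp only [impulse, homSol_init m _ hj, if_pos hjk]
          rw [Finset.sum_range_succ] at e1
          simp only [hg, Finset.sum_range_succ, zero_add] at e0 e1 ⊢
          rw [Finset.sum_congr rfl fun i hi => by
            rw [homSol_init m d (Finset.mem_range.1 hi)]] at e1
          rw [hjk]
          field_simp
          linarith
        · rw [m.homSol_init d (by omega), m.impulse_eq_zero (by omega)]; ring
    have h2 := ih fun i => d (i + 1)
    rw [h2, h1, Finset.sum_range_succ', add_assoc, add_comm (m.impulse n * g 0)]
    congr 2
    refine Finset.sum_congr rfl fun i _ => ?_
    congr 1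
    · congr 1; omega
    · refine Finset.sum_congr rfl fun j _ => ?_
      congr 2; ring

/-- Comparison with the zero sequence. The constant `K` is exposed so that the same one serves the
homogeneous part and the impulse response. -/
theorem ZeroStable.abs_le {m : LMM k} {K : ℝ} (hK : ∀ u v : ℕ → ℝ,
    (∀ n, ∑ j ∈ Finset.range (k + 1), m.α j * u (n + j) = 0) →
    (∀ n, ∑ j ∈ Finset.range (k + 1), m.α j * v (n + j) = 0) →
    ∀ M : ℝ, (∀ j < k, |u j - v j| ≤ M) → ∀ n, |u n - v n| ≤ K * M)
    {x : ℕ → ℝ} {M : ℝ} (hx : ∀ j < k, |x j| ≤ M) (n : ℕ) : |m.homSol x n| ≤ K * M := by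
  have := hK (m.homSol x) 0 (m.homSol_sum x) (by simp) M
    (fun j hj => by simpa [homSol_init m x hj] using hx j hj) n
  simpa using this

variable {E : Type*} [NormedAddCommGroup E] [NormedSpace ℝ E]

/-- Stability of the inhomogeneous recurrence in normed spaces. -/
theorem ZeroStable.norm_le {m : LMM k} (hm : m.ZeroStable) (hk : 1 ≤ k) :
    ∃ Λ : ℝ, 0 ≤ Λ ∧ ∀ (d : ℕ → E) (A : ℝ), (∀ j < k, ‖d j‖ ≤ A) → ∀ n,
      ‖d n‖ ≤ Λ * (A + ∑ i ∈ Finset.range (n + 1 - k),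
        ‖∑ j ∈ Finset.range (k + 1), m.α j • d (i + j)‖) := by
  obtain ⟨K, hK⟩ := hm
  set c := |m.α k|⁻¹ with hc
  have hc0 : 0 ≤ c := by positivity
  have himp : ∀ n, |m.impulse n| ≤ |K| * c := fun n =>
    (ZeroStable.abs_le hK (M := c) (fun j _ => by
      split_ifs
      · rw [abs_inv]
      · simpa using hc0) n).trans (by gcongr; exact le_abs_self K)
  refine ⟨|K| * (1 + c), by positivity, fun d A hA n => ?_⟩
  have hA0 : 0 ≤ A := (norm_nonneg _).trans (hA 0 hk)
  set S := ∑ i ∈ Finset.range (n + 1 - k),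
    ‖∑ j ∈ Finset.range (k + 1), m.α j • d (i + j)‖ with hS
  have hS0 : 0 ≤ S := Finset.sum_nonneg fun _ _ => norm_nonneg _
  -- A norming functional of `d n` reduces the estimate to the scalar recurrence.
  obtain ⟨l, hl1, hl⟩ := exists_dual_vector'' ℝ (d n)
  have hle : ∀ x, |l x| ≤ ‖x‖ := fun x => by
    simpa using l.le_of_opNorm_le hl1 x
  have key := m.eq_homSol_add_sum_impulse hk n fun i => l (d i)
  have h1 : |m.homSol (fun i => l (d i)) n| ≤ |K| * A :=
    (ZeroStable.abs_le hK (fun j hj => (hle _).trans (hA j hj)) n).trans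
      (by gcongr; exact le_abs_self K)
  have h2 : |∑ i ∈ Finset.range n, m.impulse (n - 1 - i) *
      ∑ j ∈ Finset.range (k + 1), m.α j * l (d (i + j))| ≤ |K| * c * S := by
    -- The first `k - 1` impulse values vanish, so only residuals with `i + k ≤ n` contribute, none
    -- reaching beyond `d n`.
    have hsub : ∑ i ∈ Finset.range n, m.impulse (n - 1 - i) *
        ∑ j ∈ Finset.range (k + 1), m.α j * l (d (i + j)) =
        ∑ i ∈ Finset.range (n + 1 - k), m.impulse (n - 1 - i) *
        ∑ j ∈ Finset.range (k + 1), m.α j * l (d (i + j)) := by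
      symm
      refine Finset.sum_subset (Finset.range_subset_range.2 (by omega)) fun i hi hi' => ?_
      simp only [Finset.mem_range] at hi hi'
      rw [m.impulse_eq_zero (by omega), zero_mul]
    rw [hsub, hS, Finset.mul_sum]
    refine (Finset.abs_sum_le_sum_abs _ _).trans (Finset.sum_le_sum fun i _ => ?_)
    rw [abs_mul]
    refine mul_le_mul (himp _) ?_ (abs_nonneg _) (by positivity)
    simpa using hle (∑ j ∈ Finset.range (k + 1), m.α j • d (i + j))
  have h3 : ‖d n‖ = l (d n) := by simpa using hl.symm
  rw [h3, key]
  refine (le_abs_self _).trans ((abs_add_le _ _).trans ((add_le_add h1 h2).trans ?_))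
  nlinarith [mul_nonneg (mul_nonneg (abs_nonneg K) hc0) hA0, mul_nonneg (abs_nonneg K) hS0]

/-- A Gronwall argument for errors that satisfy the recurrence with a Lipschitz perturbation, where
the perturbation is controlled only as long as the preceding errors are at most `1`. -/
theorem norm_le_of_recurrence_le {m : LMM k} (hk : 1 ≤ k) {Λ : ℝ} (hΛ : 0 ≤ Λ)
    {d : ℕ → E} {A : ℝ} (hd : ∀ j < k, ‖d j‖ ≤ A)
    (hstab : ∀ n, ‖d n‖ ≤ Λ * (A + ∑ i ∈ Finset.range (n + 1 - k),
        ‖∑ j ∈ Finset.range (k + 1), m.α j • d (i + j)‖))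
    {N : ℕ} {η ρ : ℝ} (hη : 0 ≤ η) (hρ : 0 ≤ ρ)
    (hrec : ∀ n, n + k ≤ N → (∀ l < n + k, ‖d l‖ ≤ 1) →
      ‖∑ j ∈ Finset.range (k + 1), m.α j • d (n + j)‖ ≤
        η * (∑ j ∈ Finset.range (k + 1), ‖d (n + j)‖) + ρ)
    (hsmall : 2 * Λ * (η * (k + 1)) ≤ 1)
    (hbound : 2 * Λ * (A + N * ρ) * Real.exp (2 * Λ * (η * (k + 1)) * N) ≤ 1) :
    ∀ n ≤ N, ‖d n‖ ≤ 2 * Λ * (A + N * ρ) * Real.exp (2 * Λ * (η * (k + 1)) * N) := by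
  set c := 2 * Λ * (η * (k + 1)) with hc
  have hc0 : 0 ≤ c := by positivity
  have hA0 : 0 ≤ A := (norm_nonneg _).trans (hd 0 hk)
  set a := 2 * Λ * (A + N * ρ) with ha
  have ha0 : 0 ≤ a := by positivity
  have hexp : ∀ n ≤ N, a * (1 + c) ^ n ≤ a * Real.exp (c * N) := fun n hn => by
    gcongr
    calc (1 + c) ^ n ≤ Real.exp c ^ n := by
          gcongr; linarith [Real.add_one_le_exp c]
      _ = Real.exp (c * n) := by rw [← Real.exp_nat_mul, mul_comm]
      _ ≤ Real.exp (c * N) := by gcongr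
  suffices h : ∀ n ≤ N, ‖d n‖ ≤ a * (1 + c) ^ n from fun n hn => (h n hn).trans (hexp n hn)
  intro n
  induction n using Nat.strong_induction_on with
  | _ n ih =>
    intro hn
    -- The bound being proved, with `hbound`, supplies the smallness that `hrec` requires of
    -- strictly earlier errors.
    have hprev : ∀ l < n, ‖d l‖ ≤ 1 := fun l hl =>
      (ih l hl (by omega)).trans ((hexp l (by omega)).trans hbound)
    have hsum : ∑ i ∈ Finset.range (n + 1 - k),
        ‖∑ j ∈ Finset.range (k + 1), m.α j • d (i + j)‖ ≤
        η * (k + 1) * (∑ l ∈ Finset.range (n + 1), ‖d l‖) + N * ρ := by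
      calc _ ≤ ∑ i ∈ Finset.range (n + 1 - k),
            (η * (∑ j ∈ Finset.range (k + 1), ‖d (i + j)‖) + ρ) := by
            refine Finset.sum_le_sum fun i hi => ?_
            have := Finset.mem_range.1 hi
            exact hrec i (by omega) fun l hl => hprev l (by omega)
        _ = η * (∑ j ∈ Finset.range (k + 1), ∑ i ∈ Finset.range (n + 1 - k), ‖d (i + j)‖)
            + (n + 1 - k : ℕ) * ρ := by
            rw [Finset.sum_add_distrib, ← Finset.mul_sum, Finset.sum_comm]
            simp
        -- For each shift `j`, every `‖d l‖` occurs at most once.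
        _ ≤ η * (∑ j ∈ Finset.range (k + 1), ∑ l ∈ Finset.range (n + 1), ‖d l‖)
            + N * ρ := by
            gcongr with j hj
            · have hj := Finset.mem_range.1 hj
              refine (Finset.sum_map (Finset.range (n + 1 - k)) (addRightEmbedding j)
                (fun l => ‖d l‖)).symm.le.trans ?_
              refine Finset.sum_le_sum_of_subset_of_nonneg (fun l hl => ?_)
                fun _ _ _ => norm_nonneg _
              simp only [Finset.mem_map, Finset.mem_range, addRightEmbedding_apply] at hl ⊢
              obtain ⟨i, hi, rfl⟩ := hl
              omega
            · omega
        _ = _ := by rw [Finset.sum_const]; simp; ring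
    -- The sum includes `‖d n‖` itself, with coefficient at most `1 / 2` by `hsmall`; absorbing it
    -- on the left produces the factor `2` in `a` and `c`.
    have hmain : ‖d n‖ ≤ a + c * ∑ l ∈ Finset.range n, ‖d l‖ := by
      have h1 := (hstab n).trans (mul_le_mul_of_nonneg_left (add_le_add_right hsum A) hΛ)
      rw [Finset.sum_range_succ] at h1
      have h2 : c * ‖d n‖ ≤ ‖d n‖ := by nlinarith [norm_nonneg (d n)]
      have h3 : Λ * (A + (η * (k + 1) * (∑ l ∈ Finset.range n, ‖d l‖ + ‖d n‖) + N * ρ))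
          = a / 2 + c / 2 * (∑ l ∈ Finset.range n, ‖d l‖) + c * ‖d n‖ / 2 := by
        rw [ha, hc]; ring
      linarith
    refine hmain.trans ?_
    have hgeom : a + c * ∑ l ∈ Finset.range n, a * (1 + c) ^ l = a * (1 + c) ^ n := by
      have := mul_geom_sum (1 + c) n
      rw [← Finset.mul_sum]
      linear_combination a * this
    rw [← hgeom]
    gcongr with l hl
    have := Finset.mem_range.1 hl
    exact ih l this (by omega)

end LMM

/-! ### Linear differential equations -/

section LinearODE

variable {E : Type*} [NormedAddCommGroup E] [NormedSpace ℝ E]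

/-- The radial retraction onto the closed ball of radius `R`. -/
noncomputable def radialRetraction (R : ℝ) (x : E) : E := (R / max R ‖x‖) • x

theorem radialRetraction_of_norm_le {R : ℝ} (hR : 0 < R) {x : E} (hx : ‖x‖ ≤ R) :
    radialRetraction R x = x := by
  rw [radialRetraction, max_eq_left hx, div_self hR.ne', one_smul]

theorem norm_radialRetraction_le {R : ℝ} (hR : 0 < R) (x : E) :
    ‖radialRetraction R x‖ ≤ R ∧ ‖radialRetraction R x‖ ≤ ‖x‖ := by
  have h0 : 0 < max R ‖x‖ := hR.trans_le (le_max_left _ _)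
  rw [radialRetraction, norm_smul, Real.norm_of_nonneg (by positivity), div_mul_eq_mul_div]
  constructor
  · rw [div_le_iff₀ h0]
    exact mul_le_mul_of_nonneg_left (le_max_right _ _) hR.le
  · rw [div_le_iff₀ h0, mul_comm]
    exact mul_le_mul_of_nonneg_left (le_max_left _ _) (norm_nonneg _)

/-- In an arbitrary norm, moving the point at fixed scale costs `‖x - y‖`, and changing the scale
costs as much again. -/
theorem norm_radialRetraction_sub_le {R : ℝ} (hR : 0 < R) (x y : E) :
    ‖radialRetraction R x - radialRetraction R y‖ ≤ 2 * ‖x - y‖ := by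
  have hx : 0 < max R ‖x‖ := hR.trans_le (le_max_left _ _)
  have hy : 0 < max R ‖y‖ := hR.trans_le (le_max_left _ _)
  have hsplit : radialRetraction R x - radialRetraction R y =
      (R / max R ‖x‖) • (x - y) + (R / max R ‖x‖ - R / max R ‖y‖) • y := by
    simp only [radialRetraction]; module
  have hRx : R / max R ‖x‖ ≤ 1 := (div_le_one hx).2 (le_max_left _ _)
  have h1 : ‖(R / max R ‖x‖) • (x - y)‖ ≤ ‖x - y‖ := by
    rw [norm_smul, Real.norm_of_nonneg (by positivity)]
    exact mul_le_of_le_one_left (norm_nonneg _) hRx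
  have h2 : ‖(R / max R ‖x‖ - R / max R ‖y‖) • y‖ ≤ ‖x - y‖ := by
    have hd : |max R ‖y‖ - max R ‖x‖| ≤ ‖x - y‖ := by
      refine (abs_max_sub_max_le_max _ _ _ _).trans ?_
      rw [sub_self, abs_zero, max_eq_right (abs_nonneg _), norm_sub_rev]
      exact abs_norm_sub_norm_le y x
    have he : R / max R ‖x‖ - R / max R ‖y‖ =
        R / max R ‖x‖ * ((max R ‖y‖ - max R ‖x‖) / max R ‖y‖) := by
      field_simp
    rw [norm_smul, he, Real.norm_eq_abs, abs_mul,
      abs_of_nonneg (by positivity : 0 ≤ R / max R ‖x‖), abs_div, abs_of_pos hy]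
    have hyy : ‖y‖ / max R ‖y‖ ≤ 1 := (div_le_one hy).2 (le_max_right _ _)
    calc R / max R ‖x‖ * (|max R ‖y‖ - max R ‖x‖| / max R ‖y‖) * ‖y‖
        = R / max R ‖x‖ * (|max R ‖y‖ - max R ‖x‖| * (‖y‖ / max R ‖y‖)) := by ring
      _ ≤ 1 * (‖x - y‖ * 1) := by gcongr
      _ = ‖x - y‖ := by ring
  rw [hsplit, two_mul]
  exact (norm_add_le _ _).trans (add_le_add h1 h2)

/-- Global existence for inhomogeneous linear equations with continuous coefficients. -/
theorem exists_hasDerivWithinAt_linear [CompleteSpace E] {t₀ T : ℝ} (hT : t₀ ≤ T)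
    {A : ℝ → E →L[ℝ] E} {b : ℝ → E} (hA : ContinuousOn A (Icc t₀ T))
    (hb : ContinuousOn b (Icc t₀ T)) :
    ∃ x : ℝ → E, x t₀ = 0 ∧
      ∀ t ∈ Icc t₀ T, HasDerivWithinAt x (A t (x t) + b t) (Icc t₀ T) t := by
  obtain ⟨K, hK⟩ := isCompact_Icc.exists_bound_of_continuousOn hA
  obtain ⟨B, hB⟩ := isCompact_Icc.exists_bound_of_continuousOn hb
  have hK0 : 0 ≤ K := (norm_nonneg _).trans (hK t₀ ⟨le_rfl, hT⟩)
  have hB0 : 0 ≤ B := (norm_nonneg _).trans (hB t₀ ⟨le_rfl, hT⟩)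
  have hT0 : 0 ≤ T - t₀ := sub_nonneg.2 hT
  -- `R` exceeds the a priori Gronwall bound. The field truncated at radius `R` is bounded, so
  -- Picard–Lindelöf applies on the whole interval at once; its solution stays within `R`, where the
  -- truncation does nothing.
  set R : ℝ := gronwallBound 0 K B (T - t₀) + 1 with hR
  have hg0 : gronwallBound 0 K B 0 = 0 := gronwallBound_x0 _ _ _
  have hmono := gronwallBound_mono (δ := 0) le_rfl hB0 hK0
  have hR0 : 0 < R := by
    have := hmono hT0
    rw [hg0] at this
    linarith
  set v : ℝ → E → E := fun t x => A t (radialRetraction R x) + b t with hv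
  have hvbound : ∀ t ∈ Icc t₀ T, ∀ x, ‖v t x‖ ≤ K * ‖radialRetraction R x‖ + B := fun t ht x =>
    (norm_add_le _ _).trans (add_le_add ((A t).le_of_opNorm_le (hK t ht) _) (hB t ht))
  have hPL : IsPicardLindelof v (⟨t₀, le_rfl, hT⟩ : Icc t₀ T) (0 : E)
      (((K * R + B) * (T - t₀)).toNNReal) 0 ((K * R + B).toNNReal) (2 * K).toNNReal :=
    { lipschitzOnWith := fun t ht => by
        refine LipschitzWith.lipschitzOnWith (LipschitzWith.of_dist_le_mul fun x y => ?_)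
        rw [dist_eq_norm, dist_eq_norm, Real.coe_toNNReal _ (by positivity)]
        have : v t x - v t y = A t (radialRetraction R x - radialRetraction R y) := by
          simp [hv]
        rw [this]
        calc _ ≤ K * ‖radialRetraction R x - radialRetraction R y‖ :=
              (A t).le_of_opNorm_le (hK t ht) _
          _ ≤ K * (2 * ‖x - y‖) := by gcongr; exact norm_radialRetraction_sub_le hR0 x y
          _ = _ := by ring
      continuousOn := fun x _ => (hA.clm_apply continuousOn_const).add hb
      norm_le := fun t ht x _ => by
        rw [Real.coe_toNNReal _ (by positivity)]
        refine (hvbound t ht x).trans ?_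
        gcongr
        exact (norm_radialRetraction_le hR0 x).1
      mul_max_le := by
        rw [Real.coe_toNNReal _ (by positivity), Real.coe_toNNReal _ (by positivity)]
        simp [hT0] }
  obtain ⟨x, hx0, hx⟩ := hPL.exists_eq_forall_mem_Icc_hasDerivWithinAt₀
  have hx0' : x t₀ = 0 := hx0
  have hcont : ContinuousOn x (Icc t₀ T) := fun t ht => (hx t ht).continuousWithinAt
  have hbd : ∀ t ∈ Icc t₀ T, ‖x t‖ ≤ gronwallBound 0 K B (t - t₀) := by
    refine norm_le_gronwallBound_of_norm_deriv_right_le hcont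
      (fun t ht => (hx t (Ico_subset_Icc_self ht)).mono_of_mem_nhdsWithin
        (Icc_mem_nhdsGE_of_mem ht)) (by simp [hx0']) fun t ht => ?_
    refine (hvbound t (Ico_subset_Icc_self ht) _).trans ?_
    gcongr
    exact (norm_radialRetraction_le hR0 _).2
  refine ⟨x, hx0', fun t ht => ?_⟩
  have hle : ‖x t‖ ≤ R := by
    have := hmono (show t - t₀ ≤ T - t₀ by linarith [ht.2])
    linarith [hbd t ht]
  simpa only [hv, radialRetraction_of_norm_le hR0 hle] using hx t ht

end LinearODE

/-! ### Taylor's theorem -/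

section Taylor

variable {E : Type*} [NormedAddCommGroup E] [NormedSpace ℝ E]

/-- Taylor's theorem along a chain of derivatives on an interval. -/
theorem norm_sub_taylor_sum_le {a b M : ℝ} (hM0 : 0 ≤ M) (N : ℕ) : ∀ {D : ℕ → ℝ → E},
    (∀ i < N, ∀ t ∈ Icc a b, HasDerivWithinAt (D i) (D (i + 1) t) (Icc a b) t) →
    (∀ t ∈ Icc a b, ‖D N t‖ ≤ M) → ∀ {t s : ℝ}, a ≤ t → 0 ≤ s → t + s ≤ b →
    ‖D 0 (t + s) - ∑ i ∈ Finset.range N, (s ^ i / i.factorial) • D i t‖ ≤ M * s ^ N := by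
  induction N with
  | zero =>
    intro D _ hM t s ht hs hts
    simpa using hM (t + s) ⟨by linarith, hts⟩
  | succ N ih =>
    intro D hD hM t s ht hs hts
    -- The `s`-derivative of the remainder is the remainder of the shifted chain `D (i + 1)`, so the
    -- mean value inequality gains one power of `s`. The factorial is not needed.
    set φ : ℝ → E := fun x =>
      D 0 (t + x) - ∑ i ∈ Finset.range (N + 1), (x ^ i / i.factorial) • D i t with hφ
    set φ' : ℝ → E := fun x =>
      D 1 (t + x) - ∑ i ∈ Finset.range N, (x ^ i / i.factorial) • D (i + 1) t with hφ'
    have hderiv : ∀ x ∈ Icc 0 s, HasDerivWithinAt φ (φ' x) (Icc 0 s) x := by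
      intro x hx
      refine HasDerivWithinAt.sub ?_ (HasDerivAt.hasDerivWithinAt ?_)
      · have h1 := hD 0 (by omega) (t + x) ⟨by linarith [hx.1], by linarith [hx.2]⟩
        have h2 : HasDerivWithinAt (fun x : ℝ => t + x) 1 (Icc 0 s) x :=
          ((hasDerivAt_id x).const_add t).hasDerivWithinAt
        simpa using! h1.scomp x h2 fun z hz => ⟨by linarith [hz.1], by linarith [hz.2]⟩
      · simp only [Finset.sum_range_succ']
        simp only [pow_zero, Nat.factorial_zero, Nat.cast_one, div_one, one_smul]
        refine HasDerivAt.add_const _ (HasDerivAt.fun_sum fun i _ => ?_)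
        refine HasDerivAt.smul_const ?_ _
        have h3 := (hasDerivAt_pow (i + 1) x).div_const ((i + 1).factorial : ℝ)
        convert h3 using 1
        have : (i.factorial : ℝ) ≠ 0 := by positivity
        rw [Nat.factorial_succ]
        push_cast
        field_simp
    have hbound : ∀ x ∈ Ico 0 s, ‖φ' x‖ ≤ M * s ^ N := fun x hx => by
      refine (ih (D := fun i => D (i + 1)) (fun i hi => hD (i + 1) (by omega)) hM ht hx.1
        (by linarith [hx.2])).trans ?_
      have := hx.1
      gcongr
      exact hx.2.le
    have hfin := norm_image_sub_le_of_norm_deriv_le_segment' hderiv hbound s ⟨hs, le_rfl⟩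
    have h0 : φ 0 = 0 := by
      simp [hφ, Finset.sum_range_succ']
    rw [h0, sub_zero, sub_zero, mul_assoc, ← pow_succ] at hfin
    exact hfin

end Taylor

/-! ### Order conditions and the linear difference operator -/

namespace LMM

variable {k : ℕ} {E : Type*} [NormedAddCommGroup E] [NormedSpace ℝ E]

/-- The linear difference operator of the method, applied to `g` with derivative `g'`. -/
noncomputable def defect (m : LMM k) (h t : ℝ) (g g' : ℝ → E) : E :=
  ∑ j ∈ Finset.range (k + 1), (m.α j • g (t + j * h) - (h * m.β j) • g' (t + j * h))

/-- The coefficient of `h ^ q / q!` in the expansion of the linear difference operator. -/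
noncomputable def orderCoeff (m : LMM k) (q : ℕ) : ℝ :=
  ∑ j ∈ Finset.range (k + 1), (m.α j * (j : ℝ) ^ q - q * m.β j * (j : ℝ) ^ (q - 1))

/-- On the monomial `x ^ q` at `t = 0` the difference operator equals `h ^ q` times the coefficient,
which cannot be `O(h ^ (p + 1))` with `q ≤ p` unless it vanishes. -/
theorem HasOrder.orderCoeff_eq_zero {m : LMM k} {p q : ℕ} (hm : m.HasOrder p) (hq : q ≤ p) :
    m.orderCoeff q = 0 := by
  have h := hm (fun x => x ^ q) (contDiff_id.pow q) 0
  have heq : (fun h : ℝ => ∑ j ∈ Finset.range (k + 1),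
        (m.α j * (0 + j * h) ^ q - h * m.β j * deriv (fun x : ℝ => x ^ q) (0 + j * h)))
      = fun h => h ^ q * m.orderCoeff q := by
    ext h
    rw [orderCoeff, Finset.mul_sum]
    refine Finset.sum_congr rfl fun j _ => ?_
    rcases q with _ | q
    · simp
    · simp only [deriv_pow_field, Nat.add_sub_cancel, zero_add, mul_pow]; ring
  rw [heq] at h
  have h2 : (fun _ : ℝ => m.orderCoeff q) =O[𝓝[>] 0] fun h : ℝ => h ^ (p + 1 - q) := by
    obtain ⟨C, hC⟩ := h.bound
    refine IsBigO.of_bound C ?_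
    filter_upwards [hC, self_mem_nhdsWithin] with x hx (hx0 : 0 < x)
    have hxq : 0 < x ^ q := by positivity
    rw [norm_mul, show x ^ (p + 1) = x ^ q * x ^ (p + 1 - q) by
      rw [← pow_add]; congr 1; omega, norm_mul, Real.norm_of_nonneg hxq.le] at hx
    refine le_of_mul_le_mul_left (hx.trans_eq ?_) hxq
    ring
  have h3 : Tendsto (fun h : ℝ => h ^ (p + 1 - q)) (𝓝[>] 0) (𝓝 0) := by
    have : Tendsto (fun h : ℝ => h ^ (p + 1 - q)) (𝓝 0) (𝓝 (0 ^ (p + 1 - q))) :=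
      (continuous_pow _).tendsto 0
    rw [zero_pow (by omega)] at this
    exact this.mono_left nhdsWithin_le_nhds
  exact tendsto_nhds_unique tendsto_const_nhds (h2.trans_tendsto h3)

theorem HasOrder.sum_α_eq_zero {m : LMM k} {p : ℕ} (hm : m.HasOrder p) :
    ∑ j ∈ Finset.range (k + 1), m.α j = 0 := by
  simpa [orderCoeff] using hm.orderCoeff_eq_zero (Nat.zero_le p)

theorem HasOrder.one_le_steps {m : LMM k} {p : ℕ} (hm : m.HasOrder p) : 1 ≤ k := by
  rcases k with _ | k
  · exact absurd (by simpa using hm.sum_α_eq_zero) m.lead_ne_zero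
  · omega

/-- A consistent zero-stable method has `∑ β_j ≠ 0`. -/
theorem ZeroStable.sum_β_ne_zero {m : LMM k} {p : ℕ} (hs : m.ZeroStable) (hm : m.HasOrder p)
    (hp : 1 ≤ p) : ∑ j ∈ Finset.range (k + 1), m.β j ≠ 0 := by
  intro hβ
  obtain ⟨K, hK⟩ := hs
  have h0 := hm.sum_α_eq_zero
  have h1 : ∑ j ∈ Finset.range (k + 1), m.α j * (j : ℝ) = 0 := by
    have := hm.orderCoeff_eq_zero hp
    simp only [orderCoeff, pow_one, Nat.cast_one, one_mul, Nat.sub_self, pow_zero, mul_one,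
      Finset.sum_sub_distrib, hβ, sub_zero] at this
    exact this
  -- If `∑ β_j = 0`, the first two order conditions make `n ↦ n` a solution for `y' = 0`; it is
  -- unbounded, contrary to zero-stability.
  have hlin : ∀ n, ∑ j ∈ Finset.range (k + 1), m.α j * ((n + j : ℕ) : ℝ) = 0 := fun n => by
    push_cast
    simp only [mul_add, Finset.sum_add_distrib, ← Finset.sum_mul, h0, h1]
    ring
  have hb := hK (fun n => n) 0 hlin (by simp) k fun j hj => by
    simpa using hj.le
  obtain ⟨n, hn⟩ := exists_nat_gt (K * k)
  have := hb n
  simp only [Pi.zero_apply, sub_zero, Nat.abs_cast] at this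
  linarith

/-- Taylor expansion at every node, one order shorter for the derivative, whose factor `h` restores
the missing power. -/
theorem norm_defect_sub_sum_le (m : LMM k) {a b M : ℝ} (hM0 : 0 ≤ M) (N : ℕ) {D : ℕ → ℝ → E}
    (hD : ∀ i < N + 1, ∀ t ∈ Icc a b, HasDerivWithinAt (D i) (D (i + 1) t) (Icc a b) t)
    (hM : ∀ t ∈ Icc a b, ‖D (N + 1) t‖ ≤ M) {h t : ℝ} (hh : 0 ≤ h) (ht : a ≤ t)
    (htb : t + k * h ≤ b) :
    ‖m.defect h t (D 0) (D 1) -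
      ∑ q ∈ Finset.range (N + 1), (h ^ q / q.factorial * m.orderCoeff q) • D q t‖ ≤
      (∑ j ∈ Finset.range (k + 1), (|m.α j| * (j : ℝ) ^ (N + 1) + |m.β j| * (j : ℝ) ^ N)) *
        M * h ^ (N + 1) := by
  have hid : m.defect h t (D 0) (D 1) -
      ∑ q ∈ Finset.range (N + 1), (h ^ q / q.factorial * m.orderCoeff q) • D q t =
      ∑ j ∈ Finset.range (k + 1),
        (m.α j • (D 0 (t + j * h) -
            ∑ q ∈ Finset.range (N + 1), ((j * h) ^ q / q.factorial) • D q t) -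
          (h * m.β j) • (D 1 (t + j * h) -
            ∑ q ∈ Finset.range N, ((j * h) ^ q / q.factorial) • D (q + 1) t)) := by
    simp only [defect, orderCoeff, Finset.mul_sum, Finset.sum_smul]
    rw [Finset.sum_comm, ← Finset.sum_sub_distrib]
    refine Finset.sum_congr rfl fun j _ => ?_
    have : ∑ q ∈ Finset.range (N + 1), (h ^ q / q.factorial *
        (m.α j * (j : ℝ) ^ q - q * m.β j * (j : ℝ) ^ (q - 1))) • D q t =
        m.α j • (∑ q ∈ Finset.range (N + 1), ((j * h) ^ q / q.factorial) • D q t) -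
        (h * m.β j) • ∑ q ∈ Finset.range N, ((j * h) ^ q / q.factorial) • D (q + 1) t := by
      simp only [Finset.sum_range_succ' _ N, smul_add, Finset.smul_sum, smul_smul]
      rw [add_sub_right_comm, ← Finset.sum_sub_distrib]
      congr 1
      · refine Finset.sum_congr rfl fun q _ => ?_
        rw [← sub_smul]
        congr 1
        have : (q.factorial : ℝ) ≠ 0 := by positivity
        rw [Nat.factorial_succ]
        push_cast
        field_simp
        ring
      · simp
    rw [this]
    simp only [smul_sub]
    abel
  rw [hid, Finset.sum_mul, Finset.sum_mul]
  refine norm_sum_le_of_le _ fun j hj => ?_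
  have hjk : (j : ℝ) ≤ k := by exact_mod_cast Nat.lt_succ_iff.1 (Finset.mem_range.1 hj)
  have hjb : t + j * h ≤ b := le_trans (by gcongr) htb
  have h1 := norm_sub_taylor_sum_le hM0 (N + 1) hD hM ht (by positivity) hjb
  have h2 := norm_sub_taylor_sum_le hM0 N (D := fun i => D (i + 1))
    (fun i hi => hD (i + 1) (by omega)) hM ht (by positivity) hjb
  refine (norm_sub_le _ _).trans ?_
  rw [norm_smul, norm_smul, Real.norm_eq_abs, Real.norm_eq_abs, abs_mul, abs_of_nonneg hh]
  calc _ ≤ |m.α j| * (M * (j * h) ^ (N + 1)) + h * |m.β j| * (M * (j * h) ^ N) := by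
        gcongr
    _ = _ := by ring

/-- The form used for differential equations: `g'` may be the right-hand side along the solution,
and compactness bounds the top derivative. -/
theorem exists_norm_defect_sub_sum_le (m : LMM k) {a b : ℝ} (hab : a < b) (N : ℕ)
    {g g' : ℝ → E} (hg : ContDiffOn ℝ ((N + 1 : ℕ) : WithTop ℕ∞) g (Icc a b))
    (hg' : ∀ t ∈ Icc a b, HasDerivWithinAt g (g' t) (Icc a b) t) :
    ∃ K : ℝ, 0 ≤ K ∧ ∀ h t : ℝ, 0 ≤ h → a ≤ t → t + k * h ≤ b →
      ‖m.defect h t g g' - ∑ q ∈ Finset.range (N + 1),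
        (h ^ q / q.factorial * m.orderCoeff q) • iteratedDerivWithin q g (Icc a b) t‖ ≤
        K * h ^ (N + 1) := by
  have hu := uniqueDiffOn_Icc hab
  obtain ⟨M, hM⟩ := isCompact_Icc.exists_bound_of_continuousOn
    (hg.continuousOn_iteratedDerivWithin le_rfl hu)
  have hM0 : 0 ≤ M := (norm_nonneg _).trans (hM a ⟨le_rfl, hab.le⟩)
  have hD : ∀ i < N + 1, ∀ t ∈ Icc a b, HasDerivWithinAt (iteratedDerivWithin i g (Icc a b))
      (iteratedDerivWithin (i + 1) g (Icc a b) t) (Icc a b) t := fun i hi t ht => by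
    rw [iteratedDerivWithin_succ]
    exact (hg.differentiableOn_iteratedDerivWithin (by exact_mod_cast hi) hu t
      ht).hasDerivWithinAt
  refine ⟨(∑ j ∈ Finset.range (k + 1),
      (|m.α j| * (j : ℝ) ^ (N + 1) + |m.β j| * (j : ℝ) ^ N)) * M,
    by positivity, fun h t hh ht htb => ?_⟩
  have hdef : m.defect h t g g' = m.defect h t (iteratedDerivWithin 0 g (Icc a b))
      (iteratedDerivWithin 1 g (Icc a b)) := by
    refine Finset.sum_congr rfl fun j hj => ?_
    have hjk : (j : ℝ) ≤ k := by exact_mod_cast Nat.lt_succ_iff.1 (Finset.mem_range.1 hj)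
    have hmem : t + j * h ∈ Icc a b :=
      ⟨le_trans ht (le_add_of_nonneg_right (by positivity)), le_trans (by gcongr) htb⟩
    rw [iteratedDerivWithin_zero, iteratedDerivWithin_one,
      (hg' _ hmem).derivWithin (hu _ hmem)]
  rw [hdef]
  exact m.norm_defect_sub_sum_le hM0 N hD hM hh ht htb

end LMM

/-! ### Local estimates for the right-hand side -/

theorem ContDiffOn.exists_lipschitzOnWith_of_isCompact {X Y : Type*} [NormedAddCommGroup X]
    [NormedSpace ℝ X] [NormedAddCommGroup Y] [NormedSpace ℝ Y] {G : X → Y} {S K : Set X}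
    (hG : ContDiffOn ℝ 1 G S) (hS : Convex ℝ S) (hK : IsCompact K) (hKS : K ⊆ S) :
    ∃ L : ℝ≥0, LipschitzOnWith L G K :=
  LocallyLipschitzOn.exists_lipschitzOnWith_of_compact hK
    (LocallyLipschitzOn.mono (fun x hx => (hG x hx).exists_lipschitzOnWith hS) hKS)

section RightHandSide

variable {E : Type*} [NormedAddCommGroup E] [NormedSpace ℝ E]

/-- The derivative of `f` in its second argument, computed from the derivative of the uncurried
function within the strip `[t₀, T] × E`. -/
noncomputable def spatialDeriv (f : ℝ → E → E) (t₀ T : ℝ) (z : ℝ × E) : E →L[ℝ] E :=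
  (fderivWithin ℝ (fun z : ℝ × E => f z.1 z.2) (Icc t₀ T ×ˢ univ) z).comp
    (ContinuousLinearMap.inr ℝ ℝ E)

variable {f : ℝ → E → E} {t₀ T : ℝ}

theorem uniqueDiffOn_strip (hT : t₀ < T) :
    UniqueDiffOn ℝ (Icc t₀ T ×ˢ (univ : Set E)) :=
  (uniqueDiffOn_Icc hT).prod uniqueDiffOn_univ

theorem contDiffOn_spatialDeriv (hT : t₀ < T) {n : ℕ}
    (hf : ContDiffOn ℝ ((n + 1 : ℕ) : WithTop ℕ∞) (fun z : ℝ × E => f z.1 z.2)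
      (Icc t₀ T ×ˢ univ)) :
    ContDiffOn ℝ n (spatialDeriv f t₀ T) (Icc t₀ T ×ˢ univ) :=
  (hf.fderivWithin (uniqueDiffOn_strip hT) (by norm_cast)).clm_comp contDiffOn_const

theorem hasFDerivAt_spatialDeriv {n : ℕ}
    (hf : ContDiffOn ℝ ((n + 1 : ℕ) : WithTop ℕ∞) (fun z : ℝ × E => f z.1 z.2)
      (Icc t₀ T ×ˢ univ)) {t : ℝ} (ht : t ∈ Icc t₀ T) (x : E) :
    HasFDerivAt (f t) (spatialDeriv f t₀ T (t, x)) x := by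
  have h1 := (hf.differentiableOn (by norm_cast) (t, x) ⟨ht, mem_univ x⟩).hasFDerivWithinAt
  have h2 : HasFDerivWithinAt (fun x : E => (t, x)) (ContinuousLinearMap.inr ℝ ℝ E) univ x :=
    (hasFDerivAt_prodMk_right t x).hasFDerivWithinAt
  exact hasFDerivWithinAt_univ.1 (h1.comp x h2 fun z _ => ⟨ht, mem_univ z⟩)

variable [FiniteDimensional ℝ E]

theorem isCompact_Icc_prod_closedBall (R : ℝ) :
    IsCompact (Icc t₀ T ×ˢ Metric.closedBall (0 : E) R) :=
  isCompact_Icc.prod (isCompact_closedBall 0 R)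

theorem exists_lipschitz_on_ball {n : ℕ}
    (hf : ContDiffOn ℝ ((n + 1 : ℕ) : WithTop ℕ∞) (fun z : ℝ × E => f z.1 z.2)
      (Icc t₀ T ×ˢ univ)) (R : ℝ) :
    ∃ L : ℝ, 0 ≤ L ∧ ∀ t ∈ Icc t₀ T, ∀ x x' : E, ‖x‖ ≤ R → ‖x'‖ ≤ R →
      ‖f t x - f t x'‖ ≤ L * ‖x - x'‖ := by
  obtain ⟨L, hL⟩ := (hf.of_le (by norm_cast; omega)).exists_lipschitzOnWith_of_isCompact
    ((convex_Icc t₀ T).prod convex_univ) (isCompact_Icc_prod_closedBall (E := E) R)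
    (prod_mono_right (subset_univ _))
  refine ⟨L, L.2, fun t ht x x' hx hx' => ?_⟩
  have := hL.norm_sub_le (x := (t, x)) (y := (t, x')) ⟨ht, by simpa using hx⟩
    ⟨ht, by simpa using hx'⟩
  simpa [Prod.norm_def] using this

/-- Quadratic bound for the linearization error of `f` in its second argument. -/
theorem exists_norm_sub_linearization_le (hT : t₀ < T) {n : ℕ} (hn : 1 ≤ n)
    (hf : ContDiffOn ℝ ((n + 1 : ℕ) : WithTop ℕ∞) (fun z : ℝ × E => f z.1 z.2)
      (Icc t₀ T ×ˢ univ)) (R : ℝ) :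
    ∃ L : ℝ, 0 ≤ L ∧ ∀ t ∈ Icc t₀ T, ∀ x e : E, ‖x‖ + ‖e‖ ≤ R →
      ‖f t (x + e) - f t x - spatialDeriv f t₀ T (t, x) e‖ ≤ L * ‖e‖ ^ 2 := by
  obtain ⟨L, hL⟩ := ((contDiffOn_spatialDeriv hT hf).of_le
    (by exact_mod_cast hn)).exists_lipschitzOnWith_of_isCompact
    ((convex_Icc t₀ T).prod convex_univ) (isCompact_Icc_prod_closedBall (E := E) R)
    (prod_mono_right (subset_univ _))
  refine ⟨L, L.2, fun t ht x e hxe => ?_⟩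
  -- On the ball of radius `‖e‖` about `x` the derivative varies by at most `L * ‖e‖`; the mean
  -- value inequality supplies the second factor `‖e‖`.
  have hb : ∀ ξ ∈ Metric.closedBall x ‖e‖,
      ‖spatialDeriv f t₀ T (t, ξ) - spatialDeriv f t₀ T (t, x)‖ ≤ L * ‖e‖ := fun ξ hξ => by
    have hξ' : ‖ξ - x‖ ≤ ‖e‖ := by simpa [dist_eq_norm] using hξ
    have hξR : ‖ξ‖ ≤ R := by
      have := norm_add_le x (ξ - x)
      rw [add_sub_cancel] at this
      linarith
    have hxR : ‖x‖ ≤ R := by linarith [norm_nonneg e]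
    have := hL.norm_sub_le (x := (t, ξ)) (y := (t, x)) ⟨ht, by simpa using hξR⟩
      ⟨ht, by simpa using hxR⟩
    have h2 : ‖(t, ξ) - (t, x)‖ = ‖ξ - x‖ := by simp [Prod.norm_def]
    rw [h2] at this
    exact this.trans (by gcongr)
  have := (convex_closedBall x ‖e‖).norm_image_sub_le_of_norm_hasFDerivWithin_le'
    (fun ξ _ => (hasFDerivAt_spatialDeriv hf ht ξ).hasFDerivWithinAt) hb
    (Metric.mem_closedBall_self (norm_nonneg _)) (y := x + e) (by simp)
  rw [add_sub_cancel_left] at this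
  exact this.trans_eq (by ring)

end RightHandSide

/-! ### Nonlinear stability -/

namespace LMM

variable {k : ℕ} {E : Type*} [NormedAddCommGroup E] [NormedSpace ℝ E]

/-- Nonlinear stability: a grid function `z` that satisfies the method up to a small residual is
close to the numerical solution. -/
theorem ZeroStable.exists_norm_sub_le {m : LMM k} (hs : m.ZeroStable) (hk : 1 ≤ k)
    {f : ℝ → E → E} {t₀ T : ℝ} (hT : t₀ ≤ T)
    (hlip : ∀ R : ℝ, ∃ L : ℝ, 0 ≤ L ∧ ∀ t ∈ Icc t₀ T, ∀ x x' : E, ‖x‖ ≤ R → ‖x'‖ ≤ R →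
      ‖f t x - f t x'‖ ≤ L * ‖x - x'‖)
    {Z κ S M : ℝ} (hκ : 0 ≤ κ) (hS : 0 ≤ S) (hM : 0 ≤ M) (L₀ : ℝ≥0) {q : ℕ} (hq : 1 ≤ q) :
    ∃ C h₀ : ℝ, 0 < h₀ ∧ ∀ h : ℝ, 0 < h → h < h₀ → ∀ U z : ℕ → E,
      m.Generates f t₀ T h U →
      (m.IsExplicit ∨ (∀ t ∈ Icc t₀ T, LipschitzWith L₀ (f t)) ∨ StepsBoundedBy k t₀ T h M U) →
      (∀ n : ℕ, t₀ + n * h ≤ T → ‖z n‖ ≤ Z) →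
      (∀ n : ℕ, t₀ + ((n + k : ℕ) : ℝ) * h ≤ T →
        ‖∑ j ∈ Finset.range (k + 1), (m.α j • z (n + j) -
          (h * m.β j) • f (t₀ + ((n + j : ℕ) : ℝ) * h) (z (n + j)))‖ ≤ κ * h ^ (q + 1)) →
      (∀ j < k, ‖U j - z j‖ ≤ S * h ^ q) →
      ∀ n : ℕ, t₀ + n * h ≤ T → ‖U n - z n‖ ≤ C * h ^ q := by
  obtain ⟨Λ, hΛ, hstab⟩ := ZeroStable.norm_le (E := E) hs hk
  -- `Z` bounds the reference values, `1` the earlier errors, and `M` the last step to an implicitly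
  -- defined value.
  obtain ⟨L₁, hL₁, hlip⟩ := hlip (Z + 1 + M)
  set B := ∑ j ∈ Finset.range (k + 1), |m.β j| with hB
  have hB0 : 0 ≤ B := by positivity
  have hβB : ∀ j ∈ Finset.range (k + 1), |m.β j| ≤ B := fun j hj =>
    Finset.single_le_sum (f := fun j => |m.β j|) (fun _ _ => abs_nonneg _) hj
  set L : ℝ := L₁ + L₀ with hL
  have hL0 : 0 ≤ L := add_nonneg hL₁ L₀.2
  set τ := T - t₀ with hτ
  have hτ0 : 0 ≤ τ := sub_nonneg.2 hT
  set C := 2 * Λ * (S + τ * κ) * Real.exp (2 * Λ * (B * L * (k + 1)) * τ) with hC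
  have hC0 : 0 ≤ C := by positivity
  set G := 2 * Λ * (B * L * (k + 1)) with hG
  have hG0 : 0 ≤ G := by positivity
  -- This threshold gives `C * h ≤ 1` (errors stay at most `1`, as `q ≥ 1`), `G * h ≤ 1` (absorption
  -- of the implicit term) and `h ≤ 1`.
  refine ⟨C, 1 / (C + G + 1), by positivity, fun h hh hh0 U z hU hroot hz hres hst n hn => ?_⟩
  have hCG : (C + G + 1) * h < 1 := by
    rwa [lt_div_iff₀ (by positivity), mul_comm] at hh0
  have hCh : 0 ≤ C * h := by positivity
  have hGh : 0 ≤ G * h := by positivity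
  have hh1 : h ≤ 1 := by nlinarith
  have hhq : h ^ q ≤ h := by
    simpa using pow_le_pow_of_le_one hh.le hh1 hq
  have hgrid : ∀ i : ℕ, i ≤ n → t₀ + i * h ∈ Icc t₀ T := fun i hi =>
    ⟨le_add_of_nonneg_right (by positivity), le_trans (by gcongr) hn⟩
  have hnh : n * h ≤ τ := by rw [hτ]; linarith
  set d : ℕ → E := fun i => U i - z i with hd
  have hfdiff : ∀ i, i + k ≤ n → (∀ l < i + k, ‖d l‖ ≤ 1) → ∀ j ∈ Finset.range (k + 1),
      |m.β j| * ‖f (t₀ + ((i + j : ℕ) : ℝ) * h) (U (i + j)) -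
        f (t₀ + ((i + j : ℕ) : ℝ) * h) (z (i + j))‖ ≤ B * L * ‖d (i + j)‖ := by
    intro i hi hsmall j hj
    have hjk : j ≤ k := Nat.lt_succ_iff.1 (Finset.mem_range.1 hj)
    have ht := hgrid (i + j) (by omega)
    have hzle : ∀ l ≤ n, ‖z l‖ ≤ Z := fun l hl => hz l (hgrid l hl).2
    have hUle : ∀ l < i + k, ‖U l‖ ≤ Z + 1 := fun l hl => by
      have h1 := hsmall l hl
      have h2 := norm_add_le (z l) (d l)
      have h3 := hzle l (by omega)
      simp only [hd, add_sub_cancel] at h1 h2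
      linarith
    have hlocal : ‖U (i + j)‖ ≤ Z + 1 + M →
        ‖f (t₀ + ((i + j : ℕ) : ℝ) * h) (U (i + j)) -
        f (t₀ + ((i + j : ℕ) : ℝ) * h) (z (i + j))‖ ≤ L * ‖d (i + j)‖ := fun hUZ =>
      (hlip _ ht _ _ hUZ (by linarith [hzle (i + j) (by omega)])).trans
        (by gcongr; exact le_add_of_nonneg_right L₀.2)
    rw [mul_assoc]
    rcases hjk.lt_or_eq with hlt | rfl
    · exact mul_le_mul (hβB j hj) (hlocal (by linarith [hUle (i + j) (by omega)]))
        (norm_nonneg _) hB0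
    -- Only the newest value, `j = k`, escapes the induction hypothesis: it has weight zero, or a
    -- global Lipschitz constant applies, or it is within `M` of its predecessor.
    · rcases hroot with hex | hglob | hsteps
      · rw [show m.β j = 0 from hex, abs_zero, zero_mul]
        positivity
      · refine mul_le_mul (hβB j hj) ?_ (norm_nonneg _) hB0
        refine ((hglob _ ht).norm_sub_le _ _).trans ?_
        gcongr
        exact le_add_of_nonneg_left hL₁
      · refine mul_le_mul (hβB j hj) (hlocal ?_) (norm_nonneg _) hB0
        have hj1 : i + j - 1 + 1 = i + j := by omega
        have h1 := hsteps (i + j - 1) (by omega) (by rw [hj1]; exact ht.2)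
        rw [hj1] at h1
        have h2 := hUle (i + j - 1) (by omega)
        have h3 := norm_add_le (U (i + j - 1)) (U (i + j) - U (i + j - 1))
        rw [add_sub_cancel] at h3
        linarith
  have hrec : ∀ i, i + k ≤ n → (∀ l < i + k, ‖d l‖ ≤ 1) →
      ‖∑ j ∈ Finset.range (k + 1), m.α j • d (i + j)‖ ≤
        h * (B * L) * (∑ j ∈ Finset.range (k + 1), ‖d (i + j)‖) + κ * h ^ (q + 1) := by
    intro i hi hsmall
    have htk := (hgrid (i + k) hi).2
    have hid : ∑ j ∈ Finset.range (k + 1), m.α j • d (i + j) =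
        ∑ j ∈ Finset.range (k + 1), (h * m.β j) •
          (f (t₀ + ((i + j : ℕ) : ℝ) * h) (U (i + j)) -
            f (t₀ + ((i + j : ℕ) : ℝ) * h) (z (i + j))) -
        ∑ j ∈ Finset.range (k + 1), (m.α j • z (i + j) -
          (h * m.β j) • f (t₀ + ((i + j : ℕ) : ℝ) * h) (z (i + j))) := by
      simp only [hd, smul_sub, Finset.sum_sub_distrib, hU i htk]
      abel
    rw [hid]
    refine (norm_sub_le _ _).trans (add_le_add ?_ (hres i htk))
    rw [Finset.mul_sum]
    refine norm_sum_le_of_le _ fun j hj => ?_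
    rw [norm_smul, Real.norm_eq_abs, abs_mul, abs_of_pos hh, mul_assoc, mul_assoc h]
    exact mul_le_mul_of_nonneg_left (hfdiff i hi hsmall j hj) hh.le
  -- At most `τ / h` residuals accumulate, which costs one power of `h`.
  have hfin : 2 * Λ * (S * h ^ q + n * (κ * h ^ (q + 1))) *
      Real.exp (2 * Λ * (h * (B * L) * (k + 1)) * n) ≤ C * h ^ q := by
    have e1 : S * h ^ q + n * (κ * h ^ (q + 1)) ≤ (S + τ * κ) * h ^ q := by
      have : n * (κ * h ^ (q + 1)) = n * h * (κ * h ^ q) := by ring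
      rw [this, add_mul, mul_assoc τ]
      gcongr
    have e2 : 2 * Λ * (h * (B * L) * (k + 1)) * n ≤ G * τ := by
      have : 2 * Λ * (h * (B * L) * (k + 1)) * n = G * (n * h) := by rw [hG]; ring
      rw [this]
      gcongr
    calc _ ≤ 2 * Λ * ((S + τ * κ) * h ^ q) * Real.exp (G * τ) := by gcongr
      _ = C * h ^ q := by rw [hC]; ring
  have hCq : C * h ^ q ≤ 1 := by nlinarith
  exact (norm_le_of_recurrence_le hk hΛ hst (hstab d _ hst) (by positivity) (by positivity) hrec
    (by nlinarith) (hfin.trans hCq) n le_rfl).trans hfin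

end LMM

/-! ### Regularity of solutions -/

section

variable {E : Type*} [NormedAddCommGroup E] [NormedSpace ℝ E]

theorem contDiffOn_succ_of_hasDerivWithinAt {a b : ℝ} (hab : a < b) {n : ℕ} {g g' : ℝ → E}
    (hg : ∀ t ∈ Icc a b, HasDerivWithinAt g (g' t) (Icc a b) t)
    (hg' : ContDiffOn ℝ n g' (Icc a b)) :
    ContDiffOn ℝ ((n + 1 : ℕ) : WithTop ℕ∞) g (Icc a b) := by
  have hu := uniqueDiffOn_Icc hab
  push_cast
  refine (contDiffOn_succ_iff_derivWithin hu).2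
    ⟨fun t ht => (hg t ht).differentiableWithinAt, fun h => by simp at h, ?_⟩
  exact hg'.congr fun t ht => (hg t ht).derivWithin (hu t ht)

/-- A solution is as smooth as the field; substituting it back into the equation gains one more
derivative. -/
theorem contDiffOn_of_ode [CompleteSpace E] {a b : ℝ} (hab : a < b) {n : ℕ} {v : ℝ → E → E} {x : ℝ → E}
    (hv : ContDiffOn ℝ n (fun z : ℝ × E => v z.1 z.2) (Icc a b ×ˢ univ))
    (hx : ∀ t ∈ Icc a b, HasDerivWithinAt x (v t (x t)) (Icc a b) t) :
    ContDiffOn ℝ ((n + 1 : ℕ) : WithTop ℕ∞) x (Icc a b) := by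
  have hxn : ContDiffOn ℝ n x (Icc a b) :=
    ODE.contDiffOn_enat_Icc_of_hasDerivWithinAt (n := (n : ℕ∞)) hv hx (mapsTo_univ _ _)
  exact contDiffOn_succ_of_hasDerivWithinAt hab hx
    (hv.comp (contDiffOn_id.prodMk hxn) fun t ht => ⟨ht, mem_univ _⟩)

theorem ContDiffOn.exists_norm_sub_le_Icc {a b : ℝ} {g : ℝ → E}
    (hg : ContDiffOn ℝ 1 g (Icc a b)) :
    ∃ L : ℝ, 0 ≤ L ∧ ∀ s ∈ Icc a b, ∀ t ∈ Icc a b, ‖g s - g t‖ ≤ L * |s - t| := by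
  obtain ⟨L, hL⟩ := hg.exists_lipschitzOnWith_of_isCompact (convex_Icc a b) isCompact_Icc
    Subset.rfl
  exact ⟨L, L.2, fun s hs t ht => hL.norm_sub_le hs ht⟩

end

/-! ### The leading term of the global error -/

namespace LMM

variable {k : ℕ} {E : Type*} [NormedAddCommGroup E] [NormedSpace ℝ E] [FiniteDimensional ℝ E]

/-- There is a smooth function `ε`, the coefficient of `h ^ p` in the global error, such that
`y + h ^ p ε` satisfies the method up to a residual of order `h ^ (p + 2)`. -/
theorem exists_errorCoeff {t₀ T : ℝ} (hT : t₀ < T) {f : ℝ → E → E} {y : ℝ → E}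
    (hy : ∀ t ∈ Icc t₀ T, HasDerivWithinAt y (f t (y t)) (Icc t₀ T) t)
    {p : ℕ} (hp : 1 ≤ p) {m : LMM k} (horder : m.HasOrder p) (hstable : m.ZeroStable)
    (hf : ContDiffOn ℝ ((p + 1 : ℕ) : WithTop ℕ∞) (fun z : ℝ × E => f z.1 z.2)
      (Icc t₀ T ×ˢ univ)) :
    ∃ ε : ℝ → E, ε t₀ = 0 ∧ ContDiffOn ℝ 1 ε (Icc t₀ T) ∧ ∃ κ : ℝ, 0 ≤ κ ∧
      ∀ h t : ℝ, 0 < h → h ≤ 1 → t₀ ≤ t → t + k * h ≤ T →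
        ‖∑ j ∈ Finset.range (k + 1), (m.α j • (y (t + j * h) + h ^ p • ε (t + j * h)) -
          (h * m.β j) • f (t + j * h) (y (t + j * h) + h ^ p • ε (t + j * h)))‖ ≤
          κ * h ^ (p + 2) := by
  have hu := uniqueDiffOn_Icc hT
  have : CompleteSpace E := FiniteDimensional.complete ℝ E
  have hyC : ContDiffOn ℝ ((p + 2 : ℕ) : WithTop ℕ∞) y (Icc t₀ T) := contDiffOn_of_ode hT hf hy
  set Y : ℝ → E := iteratedDerivWithin (p + 1) y (Icc t₀ T) with hY
  have hYC : ContDiffOn ℝ 1 Y (Icc t₀ T) := by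
    have := contDiffOn_succ_of_hasDerivWithinAt hT (n := 0) (g := Y)
      (g' := iteratedDerivWithin (p + 2) y (Icc t₀ T)) (fun t ht => by
        rw [iteratedDerivWithin_succ]
        exact (hyC.differentiableOn_iteratedDerivWithin (by norm_cast; omega) hu t
          ht).hasDerivWithinAt)
      (by
        rw [Nat.cast_zero]
        exact contDiffOn_zero.2 (hyC.continuousOn_iteratedDerivWithin le_rfl hu))
    exact_mod_cast this
  set J : ℝ → E →L[ℝ] E := fun t => spatialDeriv f t₀ T (t, y t) with hJ
  have hJC : ContDiffOn ℝ 1 J (Icc t₀ T) :=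
    ((contDiffOn_spatialDeriv hT hf).of_le (by exact_mod_cast hp)).comp
      (contDiffOn_id.prodMk (hyC.of_le (by norm_cast; omega))) fun t ht => ⟨ht, mem_univ _⟩
  set σ := ∑ j ∈ Finset.range (k + 1), m.β j with hσ
  have hσ0 : σ ≠ 0 := hstable.sum_β_ne_zero horder hp
  set c : ℝ := m.orderCoeff (p + 1) / (p + 1).factorial with hc
  -- Dividing by `σ` lets the term `-C • Y` in the equation for `ε`, weighted by `h * β_j * h ^ p`
  -- and summed, cancel the leading defect `h ^ (p + 1) * c • Y t` of `y`.
  set C : ℝ := c / σ with hC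
  have hbC : ContDiffOn ℝ 1 (fun t => (-C) • Y t) (Icc t₀ T) := hYC.const_smul (-C)
  obtain ⟨ε, hε0, hε⟩ := exists_hasDerivWithinAt_linear hT.le hJC.continuousOn hbC.continuousOn
  have hεC : ContDiffOn ℝ ((1 + 1 : ℕ) : WithTop ℕ∞) ε (Icc t₀ T) := by
    refine contDiffOn_of_ode hT (v := fun t x => J t x + (-C) • Y t) ?_ hε
    have hfst : MapsTo (Prod.fst : ℝ × E → ℝ) (Icc t₀ T ×ˢ univ) (Icc t₀ T) := fun z hz => hz.1
    rw [Nat.cast_one]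
    exact ((hJC.comp contDiffOn_fst hfst).clm_apply contDiffOn_snd).add
      (hbC.comp contDiffOn_fst hfst)
  have hεC1 : ContDiffOn ℝ 1 ε (Icc t₀ T) := hεC.of_le (by norm_cast)
  refine ⟨ε, hε0, hεC1, ?_⟩
  obtain ⟨K₁, hK₁, hdefy⟩ := m.exists_norm_defect_sub_sum_le hT (p + 1) hyC hy
  obtain ⟨K₂, hK₂, hdefε⟩ := m.exists_norm_defect_sub_sum_le hT 1 hεC hε
  obtain ⟨L, hL, hYL⟩ := hYC.exists_norm_sub_le_Icc
  obtain ⟨My, hMy⟩ := isCompact_Icc.exists_bound_of_continuousOn hyC.continuousOn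
  obtain ⟨Mε, hMε⟩ := isCompact_Icc.exists_bound_of_continuousOn hεC.continuousOn
  have hMε0 : 0 ≤ Mε := (norm_nonneg _).trans (hMε t₀ ⟨le_rfl, hT.le⟩)
  obtain ⟨Q, hQ, hquad⟩ := exists_norm_sub_linearization_le hT hp hf (My + Mε)
  set B := ∑ j ∈ Finset.range (k + 1), |m.β j| with hB
  have hB0 : 0 ≤ B := by positivity
  refine ⟨K₁ + K₂ + B * (Q * Mε ^ 2) + B * (|C| * (L * k)), by positivity,
    fun h t hh hh1 ht htk => ?_⟩
  have hmem : ∀ j ∈ Finset.range (k + 1), t + j * h ∈ Icc t₀ T := fun j hj => by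
    have hjk : (j : ℝ) ≤ k := by exact_mod_cast Nat.lt_succ_iff.1 (Finset.mem_range.1 hj)
    exact ⟨le_trans ht (le_add_of_nonneg_right (by positivity)), le_trans (by gcongr) htk⟩
  have hmem0 : t ∈ Icc t₀ T := by simpa using hmem 0 (by simp)
  have hcoeff : ∀ q ≤ p, m.orderCoeff q = 0 := fun q hq => horder.orderCoeff_eq_zero hq
  have h1 : ‖m.defect h t y (fun s => f s (y s)) - (h ^ (p + 1) * c) • Y t‖ ≤
      K₁ * h ^ (p + 2) := by
    have := hdefy h t hh.le ht htk
    rw [Finset.sum_range_succ, Finset.sum_eq_zero, zero_add] at this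
    · rwa [div_mul_eq_mul_div, mul_div_assoc] at this
    · intro q hq
      rw [hcoeff q (Nat.lt_succ_iff.1 (Finset.mem_range.1 hq)), mul_zero, zero_smul]
  -- As `p ≥ 1`, the order conditions for `q = 0, 1` hold, and `ε` being `C²` suffices.
  have h2 : ‖m.defect h t ε (fun s => J s (ε s) + (-C) • Y s)‖ ≤ K₂ * h ^ 2 := by
    have := hdefε h t hh.le ht htk
    rwa [Finset.sum_eq_zero, sub_zero] at this
    intro q hq
    rw [hcoeff q (by have := Finset.mem_range.1 hq; omega), mul_zero, zero_smul]
  have h3 : ‖∑ j ∈ Finset.range (k + 1), (h * m.β j) •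
      (f (t + j * h) (y (t + j * h) + h ^ p • ε (t + j * h)) - f (t + j * h) (y (t + j * h)) -
        J (t + j * h) (h ^ p • ε (t + j * h)))‖ ≤ B * (Q * Mε ^ 2) * h ^ (p + 2) := by
    rw [hB, Finset.sum_mul, Finset.sum_mul]
    refine norm_sum_le_of_le _ fun j hj => ?_
    have hpow : h ^ p ≤ 1 := pow_le_one₀ hh.le hh1
    have he : ‖h ^ p • ε (t + j * h)‖ ≤ h ^ p * Mε := by
      rw [norm_smul, Real.norm_of_nonneg (by positivity)]
      exact mul_le_mul_of_nonneg_left (hMε _ (hmem j hj)) (by positivity)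
    have he1 : h ^ p * Mε ≤ Mε := mul_le_of_le_one_left hMε0 hpow
    have hq := hquad _ (hmem j hj) (y (t + j * h)) (h ^ p • ε (t + j * h))
      (add_le_add (hMy _ (hmem j hj)) (he.trans he1))
    -- The quadratic error has order `2 * p + 1 ≥ p + 2`, again because `p ≥ 1`.
    have hpp : h * (h ^ p) ^ 2 ≤ h ^ (p + 2) := by
      rw [← pow_mul, ← pow_succ']
      exact pow_le_pow_of_le_one hh.le hh1 (by omega)
    rw [norm_smul, Real.norm_eq_abs, abs_mul, abs_of_pos hh]
    calc _ ≤ h * |m.β j| * (Q * (h ^ p * Mε) ^ 2) := by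
          gcongr
          exact hq.trans (by gcongr)
      _ = |m.β j| * (Q * Mε ^ 2) * (h * (h ^ p) ^ 2) := by ring
      _ ≤ _ := by gcongr
  have h4 : ‖∑ j ∈ Finset.range (k + 1), (h * m.β j * h ^ p * C) • (Y (t + j * h) - Y t)‖ ≤
      B * (|C| * (L * k)) * h ^ (p + 2) := by
    rw [hB, Finset.sum_mul, Finset.sum_mul]
    refine norm_sum_le_of_le _ fun j hj => ?_
    have hjk : (j : ℝ) ≤ k := by exact_mod_cast Nat.lt_succ_iff.1 (Finset.mem_range.1 hj)
    have hYj := hYL _ (hmem j hj) t hmem0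
    rw [add_sub_cancel_left, abs_of_nonneg (by positivity)] at hYj
    rw [norm_smul, Real.norm_eq_abs, abs_mul, abs_mul, abs_mul, abs_of_pos hh,
      abs_of_nonneg (by positivity : 0 ≤ h ^ p)]
    calc _ ≤ h * |m.β j| * h ^ p * |C| * (L * (k * h)) := by
          gcongr
          exact hYj.trans (by gcongr)
      _ = _ := by ring
  -- Four contributions: the defect of `y` beyond its leading term, the defect of `ε`, the
  -- linearization error of `f`, and the variation of `Y` across the `k + 1` nodes.
  have hid : ∑ j ∈ Finset.range (k + 1), (m.α j • (y (t + j * h) + h ^ p • ε (t + j * h)) -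
          (h * m.β j) • f (t + j * h) (y (t + j * h) + h ^ p • ε (t + j * h))) =
      (m.defect h t y (fun s => f s (y s)) - (h ^ (p + 1) * c) • Y t) +
      h ^ p • m.defect h t ε (fun s => J s (ε s) + (-C) • Y s) -
      (∑ j ∈ Finset.range (k + 1), (h * m.β j) •
        (f (t + j * h) (y (t + j * h) + h ^ p • ε (t + j * h)) - f (t + j * h) (y (t + j * h)) -
          J (t + j * h) (h ^ p • ε (t + j * h)))) -
      ∑ j ∈ Finset.range (k + 1), (h * m.β j * h ^ p * C) • (Y (t + j * h) - Y t) := by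
    have hcσ : (h ^ (p + 1) * c) • Y t =
        ∑ j ∈ Finset.range (k + 1), (h * m.β j * h ^ p * C) • Y t := by
      rw [← Finset.sum_smul]
      congr 1
      have : c = C * σ := by rw [hC, div_mul_cancel₀ _ hσ0]
      rw [this, hσ, Finset.mul_sum, Finset.mul_sum]
      exact Finset.sum_congr rfl fun j _ => by ring
    rw [hcσ]
    simp only [defect, Finset.smul_sum, ← Finset.sum_sub_distrib, ← Finset.sum_add_distrib]
    refine Finset.sum_congr rfl fun j _ => ?_
    rw [map_smul]
    module
  rw [hid]
  have h2' : ‖h ^ p • m.defect h t ε (fun s => J s (ε s) + (-C) • Y s)‖ ≤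
      K₂ * h ^ (p + 2) := by
    rw [norm_smul, Real.norm_of_nonneg (by positivity)]
    calc _ ≤ h ^ p * (K₂ * h ^ 2) := by gcongr
      _ = _ := by ring
  have n1 := norm_sub_le_of_le (norm_sub_le_of_le (norm_add_le_of_le h1 h2') h3) h4
  exact n1.trans_eq (by ring)

/-- The leading term of the global error: `y_n(h) = y(t_n) + h ^ p ε(t_n) + O(h ^ (p + 1))`. -/
theorem exists_global_error_expansion {t₀ T : ℝ} (hT : t₀ < T) {f : ℝ → E → E} {y : ℝ → E}
    (hy : ∀ t ∈ Icc t₀ T, HasDerivWithinAt y (f t (y t)) (Icc t₀ T) t)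
    {p : ℕ} (hp : 1 ≤ p) {m : LMM k} (horder : m.HasOrder p) (hstable : m.ZeroStable)
    (hf : ContDiffOn ℝ ((p + 1 : ℕ) : WithTop ℕ∞) (fun z : ℝ × E => f z.1 z.2)
      (Icc t₀ T ×ˢ univ)) :
    ∃ ε : ℝ → E, ∀ S M : ℝ, 0 ≤ S → 0 ≤ M → ∀ L₀ : ℝ≥0, ∃ C h₀ : ℝ, 0 < h₀ ∧
      ∀ h : ℝ, 0 < h → h < h₀ → ∀ U : ℕ → E, m.Generates f t₀ T h U →
      (m.IsExplicit ∨ (∀ t ∈ Icc t₀ T, LipschitzWith L₀ (f t)) ∨ StepsBoundedBy k t₀ T h M U) →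
      (∀ j < k, ‖U j - y (t₀ + j * h)‖ ≤ S * h ^ (p + 1)) →
      ∀ n : ℕ, t₀ + n * h ≤ T →
        ‖U n - y (t₀ + n * h) - h ^ p • ε (t₀ + n * h)‖ ≤ C * h ^ (p + 1) := by
  obtain ⟨ε, hε0, hεC, κ, hκ, hres⟩ := exists_errorCoeff hT hy hp horder hstable hf
  -- `ε` is fixed before `S`, `M`, `L₀`, so both grids share it.
  refine ⟨ε, fun S M hS hM L₀ => ?_⟩
  have hyc : ContinuousOn y (Icc t₀ T) := fun t ht => (hy t ht).continuousWithinAt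
  obtain ⟨My, hMy⟩ := isCompact_Icc.exists_bound_of_continuousOn hyc
  obtain ⟨Mε, hMε⟩ := isCompact_Icc.exists_bound_of_continuousOn hεC.continuousOn
  have hMε0 : 0 ≤ Mε := (norm_nonneg _).trans (hMε t₀ ⟨le_rfl, hT.le⟩)
  obtain ⟨L, hL, hεL⟩ := hεC.exists_norm_sub_le_Icc
  obtain ⟨C, h₀, hh₀, hstab⟩ := hstable.exists_norm_sub_le horder.one_le_steps hT.le
    (exists_lipschitz_on_ball hf) (Z := My + Mε) hκ (by positivity : 0 ≤ S + L * k) hM L₀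
    (q := p + 1) (by omega)
  -- The last entry of the minimum keeps the starting nodes inside `[t₀, T]`.
  refine ⟨C, min h₀ (min 1 ((T - t₀) / (k + 1))), lt_min hh₀ (lt_min one_pos
    (div_pos (sub_pos.2 hT) (by positivity))), fun h hh hh' U hU hroot hst n hn => ?_⟩
  obtain ⟨hhh₀, hh1, hhk⟩ : h < h₀ ∧ h < 1 ∧ h < (T - t₀) / (k + 1) := by
    simpa only [lt_min_iff] using hh'
  have hhk' : (k : ℝ) * h ≤ T - t₀ := by
    rw [lt_div_iff₀ (by positivity)] at hhk
    linarith
  rw [sub_sub]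
  refine hstab h hh hhh₀ U (fun n => y (t₀ + n * h) + h ^ p • ε (t₀ + n * h)) hU hroot ?_ ?_ ?_
    n hn
  · intro i hi
    have hmem : t₀ + i * h ∈ Icc t₀ T := ⟨le_add_of_nonneg_right (by positivity), hi⟩
    refine norm_add_le_of_le (hMy _ hmem) ?_
    rw [norm_smul, Real.norm_of_nonneg (by positivity)]
    exact (mul_le_of_le_one_left (norm_nonneg _) (pow_le_one₀ hh.le hh1.le)).trans (hMε _ hmem)
  · intro i hi
    have hgrid : ∀ j : ℕ, t₀ + ((i + j : ℕ) : ℝ) * h = t₀ + i * h + j * h := fun j => by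
      push_cast; ring
    rw [hgrid] at hi
    simpa only [hgrid] using hres h (t₀ + i * h) hh hh1.le
      (le_add_of_nonneg_right (by positivity)) hi
  · intro j hj
    have hjk : (j : ℝ) * h ≤ k * h := by gcongr
    have hmem : t₀ + j * h ∈ Icc t₀ T :=
      ⟨le_add_of_nonneg_right (by positivity), by linarith⟩
    -- Since `ε t₀ = 0`, the Lipschitz bound makes `h ^ p • ε` of size `L * k * h ^ (p + 1)` at the
    -- starting nodes.
    have hεj := hεL _ hmem t₀ ⟨le_rfl, hT.le⟩
    rw [hε0, sub_zero, add_sub_cancel_left, abs_of_nonneg (by positivity)] at hεj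
    rw [← sub_sub]
    refine (norm_sub_le_of_le (hst j hj) (?_ : _ ≤ L * k * h ^ (p + 1))).trans_eq (by ring)
    rw [norm_smul, Real.norm_of_nonneg (by positivity)]
    calc _ ≤ h ^ p * (L * (k * h)) := by
          gcongr
          exact hεj.trans (by gcongr)
      _ = _ := by ring

end LMM

/-! ### Extrapolation -/

/-- Finitely many starting values allow a common constant and a common threshold. -/
theorem exists_uniform_bound_of_isBigO {E : Type*} [NormedAddCommGroup E] {H : Set ℝ}
    (hH : ∀ h ∈ H, 0 < h) {k q : ℕ} {g : ℕ → ℝ → E}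
    (hg : ∀ j < k, g j =O[𝓝[H] 0] fun h : ℝ => h ^ q) :
    ∃ S δ : ℝ, 0 ≤ S ∧ 0 < δ ∧ ∀ h ∈ H, h < δ → ∀ j < k, ‖g j h‖ ≤ S * h ^ q := by
  induction k with
  | zero => exact ⟨0, 1, le_rfl, one_pos, fun _ _ _ j hj => absurd hj (by omega)⟩
  | succ k ih =>
    obtain ⟨S, δ, hS, hδ, hb⟩ := ih fun j hj => hg j (by omega)
    obtain ⟨c, hc, hck⟩ := (hg k (by omega)).exists_nonneg
    obtain ⟨δ', hδ', hb'⟩ := Metric.mem_nhdsWithin_iff.1 hck.bound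
    refine ⟨S + c, min δ δ', by positivity, lt_min hδ hδ', fun h hh hlt j hj => ?_⟩
    have h0 := hH h hh
    have hpow : 0 ≤ h ^ q := by positivity
    obtain ⟨hl1, hl2⟩ := lt_min_iff.1 hlt
    rcases (Nat.lt_succ_iff.1 hj).lt_or_eq with hlt | rfl
    · exact (hb h hh hl1 j hlt).trans
        (mul_le_mul_of_nonneg_right (le_add_of_nonneg_right hc) hpow)
    · have hmem : h ∈ Metric.ball (0 : ℝ) δ' ∩ H :=
        ⟨by simpa [abs_of_pos h0] using hl2, hh⟩
      have := hb' hmem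
      simp only [mem_ofPred_eq, Real.norm_of_nonneg hpow] at this
      exact this.trans (mul_le_mul_of_nonneg_right (le_add_of_nonneg_left hS) hpow)

theorem lemma1
    {E : Type*} [NormedAddCommGroup E] [NormedSpace ℝ E] [FiniteDimensional ℝ E]
    -- the initial-value problem and its solution
    (t₀ T : ℝ) (hT : t₀ < T) (f : ℝ → E → E) (y₀ : E) (y : ℝ → E)
    (hy : IsIVPSolution f t₀ T y₀ y)
    -- the method
    (k p : ℕ) (hp : 1 ≤ p) (m : LMM k) (horder : m.HasOrder p) (hstable : m.ZeroStable)
    -- sufficient smoothness of the right-hand side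
    (hf : ContDiffOn ℝ ((p + 1 : ℕ) : WithTop ℕ∞) (fun z : ℝ × E => f z.1 z.2)
      (Icc t₀ T ×ˢ univ))
    -- the step sizes and the sequences generated on both grids; `Y h n` is `y_n(h)`
    (H : Set ℝ) (hH : ∀ h ∈ H, 0 < h) (Y : ℝ → ℕ → E)
    (hcoarse : ∀ h ∈ H, m.Generates f t₀ T h (Y h))
    (hfine : ∀ h ∈ H, m.Generates f t₀ T (h / 2) (Y (h / 2)))
    -- for implicit methods and `f` without a global Lipschitz constant: no spurious far-away roots
    (hroot : m.IsExplicit ∨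
      (∃ L : ℝ≥0, ∀ t ∈ Icc t₀ T, LipschitzWith L (f t)) ∨
      (∃ M : ℝ, ∀ h ∈ H, StepsBoundedBy k t₀ T h M (Y h) ∧
        StepsBoundedBy k t₀ T (h / 2) M (Y (h / 2))))
    -- the accuracy of the starting values on both grids
    (hstart_coarse : ∀ j < k,
      (fun h : ℝ => Y h j - y (t₀ + j * h)) =O[𝓝[H] 0] fun h : ℝ => h ^ (p + 1))
    (hstart_fine : ∀ j < k,
      (fun h : ℝ => Y (h / 2) j - y (t₀ + j * (h / 2))) =O[𝓝[H] 0] fun h : ℝ => h ^ (p + 1)) :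
    ConvergesWithOrder H t₀ T (globalExtrapolation p Y) y (p + 1) := by
  obtain ⟨ε, hexp⟩ := LMM.exists_global_error_expansion hT hy.2 hp horder hstable hf
  obtain ⟨L₀, M, hM, hroot'⟩ : ∃ (L₀ : ℝ≥0) (M : ℝ), 0 ≤ M ∧ ∀ h ∈ H,
      (m.IsExplicit ∨ (∀ t ∈ Icc t₀ T, LipschitzWith L₀ (f t)) ∨
        StepsBoundedBy k t₀ T h M (Y h)) ∧
      (m.IsExplicit ∨ (∀ t ∈ Icc t₀ T, LipschitzWith L₀ (f t)) ∨
        StepsBoundedBy k t₀ T (h / 2) M (Y (h / 2))) := by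
    rcases hroot with he | ⟨L, hL⟩ | ⟨M, hM⟩
    · exact ⟨0, 0, le_rfl, fun h _ => ⟨Or.inl he, Or.inl he⟩⟩
    · exact ⟨L, 0, le_rfl, fun h _ => ⟨Or.inr (Or.inl hL), Or.inr (Or.inl hL)⟩⟩
    · exact ⟨0, |M|, abs_nonneg M, fun h hh =>
        ⟨Or.inr (Or.inr fun n hn hnT => ((hM h hh).1 n hn hnT).trans (le_abs_self M)),
          Or.inr (Or.inr fun n hn hnT => ((hM h hh).2 n hn hnT).trans (le_abs_self M))⟩⟩
  obtain ⟨S₁, δ₁, hS₁, hδ₁, hst₁⟩ := exists_uniform_bound_of_isBigO hH hstart_coarse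
  obtain ⟨S₂, δ₂, hS₂, hδ₂, hst₂⟩ := exists_uniform_bound_of_isBigO hH hstart_fine
  obtain ⟨C₁, h₁, hh₁, hexp₁⟩ := hexp S₁ M hS₁ hM L₀
  -- The fine starting errors are measured in `h`, the expansion in `h / 2`; hence the factor `2 ^
  -- (p + 1)`.
  obtain ⟨C₂, h₂, hh₂, hexp₂⟩ := hexp (S₂ * 2 ^ (p + 1)) M (by positivity) hM L₀
  have hpow : (1 : ℝ) < 2 ^ p := one_lt_pow₀ one_lt_two (by omega)
  have hden : (0 : ℝ) < 2 ^ p - 1 := sub_pos.2 hpow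
  set a : ℝ := 2 ^ p / (2 ^ p - 1) with ha
  set b : ℝ := 1 / (2 ^ p - 1) with hb
  have ha0 : 0 ≤ a := by positivity
  have hb0 : 0 ≤ b := by positivity
  have hab : a - b = 1 := by rw [ha, hb, ← sub_div, div_self hden.ne']
  refine ⟨a * |C₂| + b * C₁, min (min δ₁ δ₂) (min h₁ h₂),
    lt_min (lt_min hδ₁ hδ₂) (lt_min hh₁ hh₂), fun h hh hlt n hn => ?_⟩
  obtain ⟨⟨hl₁, hl₂⟩, hl₃, hl₄⟩ : (h < δ₁ ∧ h < δ₂) ∧ h < h₁ ∧ h < h₂ := by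
    simpa only [lt_min_iff] using hlt
  have h0 := hH h hh
  have hgrid : t₀ + ((2 * n : ℕ) : ℝ) * (h / 2) = t₀ + n * h := by push_cast; ring
  have e₁ := hexp₁ h h0 hl₃ (Y h) (hcoarse h hh) (hroot' h hh).1 (hst₁ h hh hl₁) n hn
  have e₂ := hexp₂ (h / 2) (by positivity) (by linarith) (Y (h / 2)) (hfine h hh)
    (hroot' h hh).2 (fun j hj => (hst₂ h hh hl₂ j hj).trans_eq (by
      rw [div_pow]; field_simp)) (2 * n) (by rwa [hgrid])
  rw [hgrid] at e₂
  have e₂' : ‖Y (h / 2) (2 * n) - y (t₀ + n * h) - (h / 2) ^ p • ε (t₀ + n * h)‖ ≤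
      |C₂| * h ^ (p + 1) := by
    refine e₂.trans ?_
    gcongr
    · exact le_abs_self C₂
    · linarith
  -- This identity eliminates `ε`, while `a - b = 1` preserves `y`.
  have hcancel : a * (h / 2) ^ p = b * h ^ p := by
    rw [ha, hb, div_pow]; field_simp
  have hid : globalExtrapolation p Y h n - y (t₀ + n * h) =
      a • (Y (h / 2) (2 * n) - y (t₀ + n * h) - (h / 2) ^ p • ε (t₀ + n * h)) -
      b • (Y h n - y (t₀ + n * h) - h ^ p • ε (t₀ + n * h)) := by
    have hy1 : y (t₀ + n * h) = (a - b) • y (t₀ + n * h) := by rw [hab, one_smul]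
    rw [globalExtrapolation, ← ha, ← hb]
    simp only [smul_sub, smul_smul, hcancel]
    nth_rewrite 1 [hy1]
    module
  rw [hid]
  refine (norm_sub_le _ _).trans ?_
  rw [norm_smul, norm_smul, Real.norm_of_nonneg ha0, Real.norm_of_nonneg hb0]
  calc _ ≤ a * (|C₂| * h ^ (p + 1)) + b * (C₁ * h ^ (p + 1)) := by gcongr
    _ = _ := by ring
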